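/- Let $X\in\mathbb{R}^{n\times p}$, $y\in\mathbb{R}^n$, $\lambda,\mu\ge 0$, let $k\ge 1$ be an integer, put $Q=X^\top X+\lambda I$ and $P=\{1,\dots,p\}$, and let $V_1,\dots,V_{\min\{n,p\}}\in\mathbb{R}^p$ be eigenvectors of $X^\top X$. Let $\mathcal{P}=\{T\subseteq P:|T|\le 2\}$, $z(T)=\sum_{i\in T}z_i$, and for $z\in[0,1]^p$, $\beta\in\mathbb{R}^p$ let $$\underline{\phi_{\mathcal P}}(z,\beta)=\sup\Big\{\beta^\top R\beta+\sum_{T\in\mathcal P}\frac{\beta^\top A_T\beta}{\min\{1,z(T)\}}\Big\}\in[-\infty,+\infty],$$ the supremum being over all positive semidefinite $A_T\in\mathbb{R}^{p\times p}$ ($T\in\mathcal P$) whose entries outside $T\times T$ vanish and all $R=\sum_{j=1}^{\min\{n,p\}}\pi_jV_jV_j^\top$ with $\pi\ge 0$ such that $\sum_{T\in\mathcal P}A_T+R=Q$; here $s/0=\infty$ for $s>0$, $0/0=0$, and $\sup\emptyset=-\infty$. Consider the relaxation $$\text{(REL)}\qquad y^\top y+\inf\ -2y^\top X\beta+\mu\,e^\top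 u+\underline{\phi_{\mathcal P}}(z,\beta)\quad\text{s.t.}\quad e^\top z\le k,\ \ -u\le\beta\le u,\ \ z\in[0,1]^p,\ u\in\mathbb{R}^p_+,\ \beta\in\mathbb{R}^p,$$ where $e$ is the all-ones vector, and the problem $$\begin{aligned}(\mathrm{SDP}_{LB})\qquad y^\top y+\inf\ & -2y^\top X\beta+\mu\,e^\top u+\langle Q,B\rangle\\ \text{s.t. }& e^\top z\le k,\quad -u\le\beta\le u,\\ &\begin{pmatrix}z_i&\beta_i\\ \beta_i&B_{ii}\end{pmatrix}\succeq 0\quad(i=1,\dots,p),\\ &0\le w_{ij}\le\min\{1,z_i+z_j\},\quad \begin{pmatrix}w_{ij}&\beta_i&\beta_j\\ \beta_i&B_{ii}&B_{ij}\\ \beta_j&B_{ij}&B_{jj}\end{pmatrix}\succeq 0\quad(i<j),\\ &V_j^\top(B-\beta\beta^\top)V_j\ge 0\quad(j=1,\dots,\min\{n,p\}),\\ &\beta\in\mathbb{R}^p,\ z\in[0,1]^p,\ u\in\mathbb{R}^p_+,\ B\in\mathbb{R}^{p\times p}\text{ symmetric}.\end{aligned}$$ Then (REL) and $(\mathrm{SDP}_{LB})$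 are equivalent in the following sense. (1) They have the same optimal value. (2) For all $\beta\in\mathbb{R}^p$ and $z\in[0,1]^p$ such that $\beta_i=0$ whenever $z_i=0$, there are $(w,B)$ that satisfy the constraints of $(\mathrm{SDP}_{LB})$ involving $w$ or $B$, and $\underline{\phi_{\mathcal P}}(z,\beta)$ is the infimum of $\langle Q,B\rangle$ over all such $(w,B)$. (3) If $(\beta,z,u,w,B)$ is an optimal solution of $(\mathrm{SDP}_{LB})$, then $(\beta,z,u)$ is an optimal solution of (REL). -/

import Mathlib

open scoped Matrix

noncomputable section

namespace SparseReg

/-- The quotient `s / d` of nonnegative reals with the convention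
`s / 0 = ∞` for `s > 0` and `0 / 0 = 0`. -/
def ratio (s d : ℝ) : EReal :=
  if d = 0 then (if 0 < s then ⊤ else 0) else ((s / d : ℝ) : EReal)

/-- The matrix `XᵀX + lam I`. -/
def gram {n p : ℕ} (X : Matrix (Fin n) (Fin p) ℝ) (lam : ℝ) : Matrix (Fin p) (Fin p) ℝ :=
  Xᵀ * X + lam • (1 : Matrix (Fin p) (Fin p) ℝ)

/-- The quadratic form `βᵀ M β`. -/
def quad {p : ℕ} (M : Matrix (Fin p) (Fin p) ℝ) (β : Fin p → ℝ) : ℝ :=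
  β ⬝ᵥ (M *ᵥ β)

/-- The entrywise inner product of two matrices. -/
def matInner {p : ℕ} (M N : Matrix (Fin p) (Fin p) ℝ) : ℝ :=
  ∑ i, ∑ j, M i j * N i j

/-- `(A, R, π)` is feasible for the decomposition problem: `Q = ∑_{T ∈ Fam} A_T + R`, where each
`A_T` is positive semidefinite and vanishes off `T × T`, and
`R = V diag(π) Vᵀ = ∑ⱼ πⱼ Vⱼ Vⱼᵀ` with `π ≥ 0`, `Vⱼ` being the columns of `V`. -/
structure IsDecomposition {p m : ℕ} (Fam : Finset (Finset (Fin p)))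
    (Q : Matrix (Fin p) (Fin p) ℝ) (V : Matrix (Fin p) (Fin m) ℝ)
    (A : Finset (Fin p) → Matrix (Fin p) (Fin p) ℝ) (R : Matrix (Fin p) (Fin p) ℝ)
    (π : Fin m → ℝ) : Prop where
  sum_eq : ∑ T ∈ Fam, A T + R = Q
  supp : ∀ T ∈ Fam, ∀ i j, (i ∉ T ∨ j ∉ T) → A T i j = 0
  psd : ∀ T ∈ Fam, (A T).PosSemidef
  rem_eq : R = V * Matrix.diagonal π * Vᵀ
  nonneg : ∀ j, 0 ≤ π j

/-- The function `φ(z, β)` for the family `Fam`: the supremum of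
`βᵀ R β + ∑_{T ∈ Fam} (β_Tᵀ A_T β_T) / min {1, z(T)}` over all feasible decompositions. -/
def phi {p m : ℕ} (Fam : Finset (Finset (Fin p))) (Q : Matrix (Fin p) (Fin p) ℝ)
    (V : Matrix (Fin p) (Fin m) ℝ) (z β : Fin p → ℝ) : EReal :=
  ⨆ (A : Finset (Fin p) → Matrix (Fin p) (Fin p) ℝ) (R : Matrix (Fin p) (Fin p) ℝ)
    (π : Fin m → ℝ) (_ : IsDecomposition Fam Q V A R π),
    ((quad R β : ℝ) : EReal) + ∑ T ∈ Fam, ratio (quad (A T) β) (min 1 (∑ i ∈ T, z i))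

/-- The constraints on `(β, z, u)` shared by both problems. -/
structure BaseFeasible {p : ℕ} (k : ℕ) (β z u : Fin p → ℝ) : Prop where
  card : ∑ i, z i ≤ k
  le_u : ∀ i, β i ≤ u i
  neg_le_u : ∀ i, -β i ≤ u i
  z_mem : ∀ i, z i ∈ Set.Icc (0 : ℝ) 1
  u_nonneg : ∀ i, 0 ≤ u i

/-- The part `-2 yᵀ X β + mu eᵀ u` of the objective shared by both problems. -/
def linObj {n p : ℕ} (X : Matrix (Fin n) (Fin p) ℝ) (y : Fin n → ℝ) (mu : ℝ)
    (β u : Fin p → ℝ) : ℝ :=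
  -2 * (y ⬝ᵥ (X *ᵥ β)) + mu * ∑ i, u i

/-- The objective of the relaxation in the original space of variables (with `yᵀy`). -/
def relaxObj {n p m : ℕ} (X : Matrix (Fin n) (Fin p) ℝ) (y : Fin n → ℝ) (lam mu : ℝ)
    (Fam : Finset (Finset (Fin p))) (V : Matrix (Fin p) (Fin m) ℝ)
    (β z u : Fin p → ℝ) : EReal :=
  ((y ⬝ᵥ y + linObj X y mu β u : ℝ) : EReal) + phi Fam (gram X lam) V z β

/-- The optimal value of the relaxation in the original space of variables. -/
def relaxValue {n p m : ℕ} (X : Matrix (Fin n) (Fin p) ℝ) (y : Fin n → ℝ) (lam mu : ℝ) (k : ℕ)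
    (Fam : Finset (Finset (Fin p))) (V : Matrix (Fin p) (Fin m) ℝ) : EReal :=
  ⨅ (β : Fin p → ℝ) (z : Fin p → ℝ) (u : Fin p → ℝ) (_ : BaseFeasible k β z u),
    relaxObj X y lam mu Fam V β z u

/-- The constraints of `SDP_LB` that involve `w` or `B`, at given `(β, z)`.
Only the entries `w i j` with `i < j` matter. -/
structure InnerFeasible {p m : ℕ} (V : Matrix (Fin p) (Fin m) ℝ) (β z : Fin p → ℝ)
    (w : Fin p → Fin p → ℝ) (B : Matrix (Fin p) (Fin p) ℝ) : Prop where
  symm : B.IsSymm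
  psd_two : ∀ i, (!![z i, β i; β i, B i i] : Matrix (Fin 2) (Fin 2) ℝ).PosSemidef
  w_nonneg : ∀ i j, i < j → 0 ≤ w i j
  w_le : ∀ i j, i < j → w i j ≤ min 1 (z i + z j)
  psd_three : ∀ i j, i < j →
    (!![w i j, β i, β j;
        β i, B i i, B i j;
        β j, B i j, B j j] : Matrix (Fin 3) (Fin 3) ℝ).PosSemidef
  rank_one : ∀ j : Fin m, 0 ≤ quad (B - Matrix.vecMulVec β β) (fun i => V i j)

/-- The objective of `SDP_LB` (with `yᵀy`). -/
def sdpObj {n p : ℕ} (X : Matrix (Fin n) (Fin p) ℝ) (y : Fin n → ℝ) (lam mu : ℝ)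
    (β u : Fin p → ℝ) (B : Matrix (Fin p) (Fin p) ℝ) : ℝ :=
  y ⬝ᵥ y + linObj X y mu β u + matInner (gram X lam) B

/-- The optimal value of `SDP_LB`. -/
def sdpValue {n p m : ℕ} (X : Matrix (Fin n) (Fin p) ℝ) (y : Fin n → ℝ) (lam mu : ℝ) (k : ℕ)
    (V : Matrix (Fin p) (Fin m) ℝ) : EReal :=
  ⨅ (β : Fin p → ℝ) (z : Fin p → ℝ) (u : Fin p → ℝ) (w : Fin p → Fin p → ℝ)
    (B : Matrix (Fin p) (Fin p) ℝ) (_ : BaseFeasible k β z u) (_ : InnerFeasible V β z w B),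
    ((sdpObj X y lam mu β u B : ℝ) : EReal)

/-- The optimal value of the minimization of `⟨XᵀX + lam I, B⟩` over the variables `(w, B)` of
`SDP_LB`, at given `(β, z)`. -/
def innerValue {n p m : ℕ} (X : Matrix (Fin n) (Fin p) ℝ) (lam : ℝ)
    (V : Matrix (Fin p) (Fin m) ℝ) (β z : Fin p → ℝ) : EReal :=
  ⨅ (w : Fin p → Fin p → ℝ) (B : Matrix (Fin p) (Fin p) ℝ) (_ : InnerFeasible V β z w B),
    ((matInner (gram X lam) B : ℝ) : EReal)

/-- The family of all subsets of size at most two. -/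
def pairs (p : ℕ) : Finset (Finset (Fin p)) :=
  Finset.univ.filter (fun T => T.card ≤ 2)

end SparseReg

end

/-!
For fixed `(β, z)`, the decomposition problem defining `φ` and the minimization of `⟨Q, B⟩` over
all symmetric `B` with `(xᵀβ)² / min {1, z(T)} ≤ xᵀBx` for `x` supported on a set `T` of the family
and `(Vⱼᵀβ)² ≤ VⱼᵀBVⱼ` form a dual pair of cone programs. Strong duality holds without a Slater
condition: since `∑ A_T + ∑ πⱼVⱼVⱼᵀ = 0` with positive semidefinite summands forces every summand to
vanish, the image of the decomposition cone is closed and can be separated from any point outside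
it. By Schur complements, the constraints on `B` are those of the semidefinite program with
`w i j = min {1, z i + z j}`.

This identification requires `β i = 0` wherever `z i = 0`; at other points the semidefinite program
is infeasible, while `φ` may be finite. Such a point is pulled to
`(cβ, cz + (1 - c) / (p + 1), cu)` with `c < 1`. This does not increase `φ`, and `c → 1` recovers
the objective.
-/

section ConicDuality

variable {E F : Type*} [NormedAddCommGroup E] [NormedSpace ℝ E]
  [NormedAddCommGroup F] [NormedSpace ℝ F]

theorem exists_pos_forall_mul_norm_le_norm_map [ProperSpace E] (K : ProperCone ℝ E) (f : E →L[ℝ] F)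
    (hf : ∀ x ∈ K, f x = 0 → x = 0) : ∃ ε > 0, ∀ x ∈ K, ε * ‖x‖ ≤ ‖f x‖ := by
  have hcompact : IsCompact ((K : Set E) ∩ Metric.sphere 0 1) :=
    (isCompact_sphere 0 1).inter_left K.isClosed
  obtain ⟨ε, hε, hmin⟩ := hcompact.exists_forall_le' f.continuous.norm.continuousOn (a := 0)
    fun x ⟨hxK, hx⟩ ↦ norm_pos_iff.2 fun h ↦ by simp [hf x hxK h] at hx
  refine ⟨ε, hε, fun x hx ↦ ?_⟩
  rcases eq_or_ne x 0 with rfl | hx0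
  · simp
  have hpos : 0 < ‖x‖ := norm_pos_iff.2 hx0
  have hunit := hmin (‖x‖⁻¹ • x) ⟨K.smul_mem hx (by positivity), by simp [norm_smul, hpos.ne']⟩
  rwa [map_smul, norm_smul, norm_inv, norm_norm, inv_mul_eq_div, le_div_iff₀ hpos] at hunit

theorem isClosed_image_of_forall_map_eq_zero [ProperSpace E] (K : ProperCone ℝ E) (f : E →L[ℝ] F)
    (hf : ∀ x ∈ K, f x = 0 → x = 0) : IsClosed (f '' (K : Set E)) := by
  obtain ⟨ε, hε, hbound⟩ := exists_pos_forall_mul_norm_le_norm_map K f hf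
  refine isClosed_of_closure_subset fun y hy ↦ ?_
  let S : Set E := K ∩ Metric.closedBall 0 ((‖y‖ + 1) / ε)
  have hS : IsClosed (f '' S) :=
    (((isCompact_closedBall _ _).inter_left K.isClosed).image f.continuous).isClosed
  have hsub : Metric.ball y 1 ∩ f '' K ⊆ f '' S := by
    rintro _ ⟨hxy, x, hx, rfl⟩
    have hfx : ‖f x‖ ≤ ‖y‖ + 1 := (norm_lt_of_mem_ball hxy).le
    refine ⟨x, ⟨hx, mem_closedBall_zero_iff.2 ((le_div_iff₀' hε).2 ?_)⟩, rfl⟩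
    exact (hbound x hx).trans hfx
  have hyS : y ∈ f '' S := closure_minimal hsub hS
    (Metric.isOpen_ball.inter_closure ⟨Metric.mem_ball_self one_pos, hy⟩)
  exact Set.image_mono Set.inter_subset_left hyS

theorem exists_mem_map_eq_of_forall_nonneg [ProperSpace E] (K : ProperCone ℝ E) (f : E →L[ℝ] F)
    (hf : ∀ x ∈ K, f x = 0 → x = 0) {q : F}
    (hq : ∀ g : StrongDual ℝ F, (∀ x ∈ K, 0 ≤ g (f x)) → 0 ≤ g q) : ∃ x ∈ K, f x = q := by
  have hmap : (K.map f : Set F) = f '' K :=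
    (isClosed_image_of_forall_map_eq_zero K f hf).closure_eq
  by_contra hnot
  have hqmap : q ∉ (K.map f : Set F) := by rwa [hmap]
  obtain ⟨g, hg, hgq⟩ := (K.map f).hyperplane_separation_point hqmap
  exact hgq.not_ge (hq g fun x hx ↦ hg _ (hmap.ge ⟨x, hx, rfl⟩))

theorem nonneg_of_forall_le_add_mul {a b v : ℝ} (h : ∀ t ≥ 0, v ≤ a + t * b) : 0 ≤ b := by
  by_contra! hb
  obtain ⟨t, ht⟩ := exists_nat_gt ((a - v) / -b)
  rw [div_lt_iff₀ (neg_pos.2 hb)] at ht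
  linarith [h t t.cast_nonneg]

/-- The cone `K × [0, ∞)`, whose last coordinate serves as a slack variable. -/
def coneProdNonneg (K : ProperCone ℝ E) : ProperCone ℝ (E × ℝ) :=
  K.comap (.fst ℝ E ℝ) ⊓ (ProperCone.positive ℝ ℝ).comap (.snd ℝ E ℝ)

theorem mem_coneProdNonneg {K : ProperCone ℝ E} {x : E × ℝ} :
    x ∈ coneProdNonneg K ↔ x.1 ∈ K ∧ 0 ≤ x.2 := Iff.rfl

theorem mul_le_map_of_forall_mul_le {K : ProperCone ℝ E} {f : E →L[ℝ] F} {c : StrongDual ℝ E}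
    {q : F} {v : ℝ} {g₀ : StrongDual ℝ F} (hg₀ : ∀ x ∈ K, c x ≤ g₀ (f x))
    (hv : ∀ g : StrongDual ℝ F, (∀ x ∈ K, c x ≤ g (f x)) → v ≤ g q)
    {g : StrongDual ℝ F} {σ : ℝ} (hσ : 0 ≤ σ) (hg : ∀ x ∈ K, σ * c x ≤ g (f x)) :
    σ * v ≤ g q := by
  rcases hσ.eq_or_lt with rfl | hσ
  · simp only [zero_mul] at hg ⊢
    -- `g₀ + t • g` is dual feasible for every `t ≥ 0`
    refine nonneg_of_forall_le_add_mul (a := g₀ q) (v := v) fun t ht ↦ ?_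
    simpa using hv (g₀ + t • g) fun x hx ↦ by
      simpa using add_le_add (hg₀ x hx) (mul_nonneg ht (hg x hx))
  · have h := hv (σ⁻¹ • g) fun x hx ↦ by
      simpa [inv_mul_eq_div, le_div_iff₀ hσ, mul_comm] using hg x hx
    simpa [inv_mul_eq_div, le_div_iff₀ hσ, mul_comm] using h

theorem exists_mem_map_eq_and_le [ProperSpace E] (K : ProperCone ℝ E) (f : E →L[ℝ] F)
    (c : StrongDual ℝ E) (hf : ∀ x ∈ K, f x = 0 → x = 0) {q : F} {v : ℝ}
    {g₀ : StrongDual ℝ F} (hg₀ : ∀ x ∈ K, c x ≤ g₀ (f x))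
    (hv : ∀ g : StrongDual ℝ F, (∀ x ∈ K, c x ≤ g (f x)) → v ≤ g q) :
    ∃ x ∈ K, f x = q ∧ v ≤ c x := by
  let fslack : E × ℝ →L[ℝ] F × ℝ :=
    (f.comp (.fst ℝ E ℝ)).prod (c.comp (.fst ℝ E ℝ) - .snd ℝ E ℝ)
  have hker : ∀ x ∈ coneProdNonneg K, fslack x = 0 → x = 0 := by
    rintro ⟨x, t⟩ ⟨hx, -⟩ h0
    obtain ⟨hfx, hct⟩ : f x = 0 ∧ c x - t = 0 := Prod.ext_iff.1 h0
    obtain rfl := hf x hx hfx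
    simpa using hct
  have hsep : ∀ G : StrongDual ℝ (F × ℝ), (∀ x ∈ coneProdNonneg K, 0 ≤ G (fslack x)) →
      0 ≤ G (q, v) := by
    intro G hG
    have hsplit : ∀ y r, G (y, r) = G (y, 0) + r * G (0, 1) := fun y r ↦ by
      rw [← smul_eq_mul, ← map_smul, ← map_add]
      simp
    have hG' : ∀ x ∈ K, ∀ t ≥ 0, 0 ≤ G (f x, 0) + (c x - t) * G (0, 1) := fun x hx t ht ↦
      (hG (x, t) (mem_coneProdNonneg.2 ⟨hx, ht⟩)).trans_eq (hsplit _ _)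
    have hslack : 0 ≤ -G (0, 1) := by
      simpa [← Prod.zero_eq_mk] using hG' 0 K.zero_mem 1 zero_le_one
    have h : -G (0, 1) * v ≤ G (q, 0) :=
      mul_le_map_of_forall_mul_le hg₀ hv (g := G.comp (.inl ℝ F ℝ)) hslack fun x hx ↦ by
        rw [ContinuousLinearMap.comp_apply, ContinuousLinearMap.inl_apply]
        linarith [hG' x hx 0 le_rfl]
    rw [hsplit]
    linarith
  obtain ⟨⟨x, t⟩, ⟨hx, ht⟩, h⟩ :=
    exists_mem_map_eq_of_forall_nonneg (coneProdNonneg K) fslack hker hsep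
  obtain ⟨hfx, hct⟩ : f x = q ∧ c x - t = v := Prod.ext_iff.1 h
  exact ⟨x, hx, hfx, hct.symm.trans_le (sub_le_self _ ht)⟩

end ConicDuality

namespace SparseReg

section QuadraticForms

open Matrix

variable {p m : ℕ}

theorem matInner_comm (M N : Matrix (Fin p) (Fin p) ℝ) : matInner M N = matInner N M := by
  simp only [matInner, mul_comm]

/-- The linear functional `M ↦ ⟨M, B⟩` on matrices. -/
def matInnerₗ (B : Matrix (Fin p) (Fin p) ℝ) : Matrix (Fin p) (Fin p) ℝ →ₗ[ℝ] ℝ where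
  toFun M := matInner M B
  map_add' M N := by simp only [matInner, Matrix.add_apply, add_mul, Finset.sum_add_distrib]
  map_smul' c M := by
    simp only [matInner, Matrix.smul_apply, smul_eq_mul, mul_assoc, Finset.mul_sum,
      RingHom.id_apply]

@[simp]
theorem matInnerₗ_apply (B M : Matrix (Fin p) (Fin p) ℝ) : matInnerₗ B M = matInner M B := rfl

theorem matInner_vecMulVec (x : Fin p → ℝ) (B : Matrix (Fin p) (Fin p) ℝ) :
    matInner (vecMulVec x x) B = quad B x := by
  simp only [matInner, quad, dotProduct, mulVec, vecMulVec_apply, Finset.mul_sum]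
  exact Finset.sum_congr rfl fun i _ ↦ Finset.sum_congr rfl fun j _ ↦ by ring

theorem quad_eq_matInner (M : Matrix (Fin p) (Fin p) ℝ) (x : Fin p → ℝ) :
    quad M x = matInner M (vecMulVec x x) := by
  rw [matInner_comm, matInner_vecMulVec]

theorem quad_vecMulVec (x y : Fin p → ℝ) : quad (vecMulVec y y) x = (y ⬝ᵥ x) ^ 2 := by
  rw [quad, vecMulVec_mulVec, op_smul_eq_smul, dotProduct_smul, smul_eq_mul, dotProduct_comm x, sq]

theorem quad_zero (x : Fin p → ℝ) : quad 0 x = 0 := by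
  rw [quad, zero_mulVec, dotProduct_zero]

theorem quad_zero_right (M : Matrix (Fin p) (Fin p) ℝ) : quad M 0 = 0 := by
  rw [quad, zero_dotProduct]

theorem quad_add (M N : Matrix (Fin p) (Fin p) ℝ) (x : Fin p → ℝ) :
    quad (M + N) x = quad M x + quad N x := by
  rw [quad, add_mulVec, dotProduct_add, quad, quad]

theorem quad_sub (M N : Matrix (Fin p) (Fin p) ℝ) (x : Fin p → ℝ) :
    quad (M - N) x = quad M x - quad N x := by
  rw [quad, sub_mulVec, dotProduct_sub, quad, quad]

theorem quad_smul (c : ℝ) (M : Matrix (Fin p) (Fin p) ℝ) (x : Fin p → ℝ) :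
    quad (c • M) x = c * quad M x := by
  rw [quad, smul_mulVec, dotProduct_smul, smul_eq_mul, quad]

theorem quad_smul_right (M : Matrix (Fin p) (Fin p) ℝ) (c : ℝ) (x : Fin p → ℝ) :
    quad M (c • x) = c ^ 2 * quad M x := by
  rw [quad, mulVec_smul, dotProduct_smul, smul_dotProduct, smul_eq_mul, smul_eq_mul, quad]
  ring

theorem mul_diagonal_mul_transpose_eq_sum {ι κ R : Type*} [Fintype κ] [DecidableEq κ]
    [CommSemiring R] (V : Matrix ι κ R) (π : κ → R) :
    V * diagonal π * Vᵀ = ∑ j, π j • vecMulVec (V.col j) (V.col j) := by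
  ext a b
  rw [mul_apply]
  simp only [mul_diagonal, transpose_apply, Matrix.sum_apply, Matrix.smul_apply, vecMulVec_apply,
    col_apply, smul_eq_mul]
  exact Finset.sum_congr rfl fun j _ ↦ by ring

theorem matInner_mul_diagonal_mul_transpose (V : Matrix (Fin p) (Fin m) ℝ) (π : Fin m → ℝ)
    (B : Matrix (Fin p) (Fin p) ℝ) :
    matInner (V * diagonal π * Vᵀ) B = ∑ j, π j * quad B (V.col j) := by
  rw [mul_diagonal_mul_transpose_eq_sum, ← matInnerₗ_apply, map_sum]
  simp only [map_smul, matInnerₗ_apply, matInner_vecMulVec, smul_eq_mul]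

theorem quad_mul_diagonal_mul_transpose (V : Matrix (Fin p) (Fin m) ℝ) (π : Fin m → ℝ)
    (β : Fin p → ℝ) :
    quad (V * diagonal π * Vᵀ) β = ∑ j, π j * (V.col j ⬝ᵥ β) ^ 2 := by
  simp only [quad_eq_matInner _ β, matInner_mul_diagonal_mul_transpose, quad_vecMulVec,
    dotProduct_comm β]

theorem posSemidef_iff_isSymm_and_quad_nonneg {A : Matrix (Fin p) (Fin p) ℝ} :
    A.PosSemidef ↔ A.IsSymm ∧ ∀ x, 0 ≤ quad A x := by
  simp only [posSemidef_iff_dotProduct_mulVec, IsHermitian, conjTranspose_eq_transpose_of_trivial,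
    IsSymm, star_trivial, quad]

theorem isClosed_setOf_posSemidef : IsClosed {A : Matrix (Fin p) (Fin p) ℝ | A.PosSemidef} := by
  simp only [posSemidef_iff_isSymm_and_quad_nonneg, Set.ofPred_and, Set.ofPred_forall, quad]
  exact (isClosed_eq (by fun_prop) continuous_id).inter
    (isClosed_iInter fun x ↦ isClosed_le (by fun_prop) (by fun_prop))

open scoped MatrixOrder Matrix.Norms.L2Operator in
theorem exists_eq_sum_vecMulVec {ι : Type*} [Fintype ι] {A : Matrix ι ι ℝ}
    (hA : A.PosSemidef) : ∃ N : ι → ι → ℝ, A = ∑ k, vecMulVec (N k) (N k) := by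
  classical
  obtain ⟨N, hN⟩ := CStarAlgebra.nonneg_iff_eq_star_mul_self.mp hA.nonneg
  refine ⟨N.row, ?_⟩
  ext a b
  simp only [hN, star_eq_conjTranspose, mul_apply, conjTranspose_apply, star_trivial,
    Matrix.sum_apply, vecMulVec_apply, row_apply]

theorem eq_zero_of_sum_vecMulVec_apply_eq_zero {ι κ : Type*} [Fintype κ] {N : κ → ι → ℝ} {i : ι}
    (h : (∑ k, vecMulVec (N k) (N k)) i i = 0) (k : κ) : N k i = 0 := by
  simp only [Matrix.sum_apply, vecMulVec_apply] at h
  exact mul_self_eq_zero.1 ((Finset.sum_eq_zero_iff_of_nonneg fun k _ ↦ mul_self_nonneg (N k i)).1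
    h k (Finset.mem_univ k))

theorem matInner_transpose (M N : Matrix (Fin p) (Fin p) ℝ) :
    matInner Mᵀ Nᵀ = matInner M N := by
  simp only [matInner, transpose_apply]
  exact Finset.sum_comm

theorem exists_isSymm_forall_apply_eq_matInner (g : Matrix (Fin p) (Fin p) ℝ →ₗ[ℝ] ℝ) :
    ∃ B : Matrix (Fin p) (Fin p) ℝ, B.IsSymm ∧ ∀ M, M.IsSymm → g M = matInner M B := by
  let C : Matrix (Fin p) (Fin p) ℝ := of fun a b ↦ g (single a b 1)
  have hC : ∀ M, g M = matInner M C := fun M ↦ by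
    conv_lhs => rw [matrix_eq_sum_single M]
    have hsingle : ∀ a b, g (single a b (M a b)) = M a b * C a b := fun a b ↦ by
      change _ = M a b * g (single a b 1)
      rw [← smul_eq_mul, ← map_smul, smul_single, smul_eq_mul, mul_one]
    simp only [map_sum, hsingle, matInner]
  refine ⟨(2 : ℝ)⁻¹ • (C + Cᵀ), ?_, fun M hM ↦ ?_⟩
  · rw [IsSymm, transpose_smul, transpose_add, transpose_transpose, add_comm]
  · have hCt : matInner Cᵀ M = matInner C M := by rw [← matInner_transpose, hM, transpose_transpose]
    rw [matInner_comm, ← matInnerₗ_apply, map_smul, map_add, matInnerₗ_apply, matInnerₗ_apply, hCt,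
      hC, matInner_comm, smul_eq_mul]
    ring

end QuadraticForms

section Duality

open Matrix

variable {p m : ℕ} {Fam : Finset (Finset (Fin p))} {s : Finset (Fin p) → ℝ}
  {V : Matrix (Fin p) (Fin m) ℝ} {β : Fin p → ℝ}

/-- The matrix `B` dominates `ββᵀ / s` as a quadratic form on the vectors supported on `T`. For
`s = 0` the convention `x / 0 = 0` leaves only the positivity of `B` on these vectors. -/
def DominatesOn (T : Finset (Fin p)) (s : ℝ) (β : Fin p → ℝ) (B : Matrix (Fin p) (Fin p) ℝ) :
    Prop :=
  ∀ x : Fin p → ℝ, (∀ i ∉ T, x i = 0) → (x ⬝ᵥ β) ^ 2 / s ≤ quad B x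

/-- The feasible region of the conic dual of the decomposition problem in `phi`, where the values
`s T` are the denominators. -/
structure Dominates (Fam : Finset (Finset (Fin p))) (s : Finset (Fin p) → ℝ)
    (V : Matrix (Fin p) (Fin m) ℝ) (β : Fin p → ℝ) (B : Matrix (Fin p) (Fin p) ℝ) : Prop where
  symm : B.IsSymm
  on_mem : ∀ T ∈ Fam, DominatesOn T (s T) β B
  on_col : ∀ j, (V.col j ⬝ᵥ β) ^ 2 ≤ quad B (V.col j)

theorem DominatesOn.quad_div_le_matInner {T : Finset (Fin p)} {s : ℝ}
    {A B : Matrix (Fin p) (Fin p) ℝ} (hB : DominatesOn T s β B) (hA : A.PosSemidef)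
    (hAT : ∀ i ∉ T, A i i = 0) : quad A β / s ≤ matInner A B := by
  obtain ⟨N, rfl⟩ := exists_eq_sum_vecMulVec hA
  have hN : ∀ k, ∀ i ∉ T, N k i = 0 := fun k i hi ↦
    eq_zero_of_sum_vecMulVec_apply_eq_zero (hAT i hi) k
  rw [quad_eq_matInner, ← matInnerₗ_apply, ← matInnerₗ_apply, map_sum, map_sum, Finset.sum_div]
  refine Finset.sum_le_sum fun k _ ↦ ?_
  rw [matInnerₗ_apply, matInnerₗ_apply, matInner_vecMulVec, matInner_vecMulVec, quad_vecMulVec,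
    dotProduct_comm]
  exact hB (N k) (hN k)

theorem Dominates.value_le_matInner {B Q R : Matrix (Fin p) (Fin p) ℝ}
    {A : Finset (Fin p) → Matrix (Fin p) (Fin p) ℝ} {π : Fin m → ℝ}
    (hB : Dominates Fam s V β B) (hD : IsDecomposition Fam Q V A R π) :
    quad R β + ∑ T ∈ Fam, quad (A T) β / s T ≤ matInner Q B := by
  have hR : quad R β ≤ matInner R B := by
    rw [hD.rem_eq, quad_mul_diagonal_mul_transpose, matInner_mul_diagonal_mul_transpose]
    exact Finset.sum_le_sum fun j _ ↦ mul_le_mul_of_nonneg_left (hB.on_col j) (hD.nonneg j)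
  have hA : ∀ T ∈ Fam, quad (A T) β / s T ≤ matInner (A T) B := fun T hT ↦
    (hB.on_mem T hT).quad_div_le_matInner (hD.psd T hT) fun i hi ↦ hD.supp T hT i i (.inl hi)
  calc quad R β + ∑ T ∈ Fam, quad (A T) β / s T
      ≤ matInner R B + ∑ T ∈ Fam, matInner (A T) B := add_le_add hR (Finset.sum_le_sum hA)
    _ = matInner Q B := by
      rw [← hD.sum_eq, ← matInnerₗ_apply _ (_ + _), map_add, map_sum, add_comm]
      rfl

theorem IsDecomposition.isSymm {Q R : Matrix (Fin p) (Fin p) ℝ}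
    {A : Finset (Fin p) → Matrix (Fin p) (Fin p) ℝ} {π : Fin m → ℝ}
    (hD : IsDecomposition Fam Q V A R π) : Q.IsSymm := by
  have hR : R.IsSymm := by
    rw [IsSymm, hD.rem_eq, transpose_mul, transpose_mul, transpose_transpose, diagonal_transpose,
      Matrix.mul_assoc]
  have hA : (∑ T ∈ Fam, A T).IsSymm := by
    rw [IsSymm, transpose_sum]
    exact Finset.sum_congr rfl fun T hT ↦ (hD.psd T hT).isHermitian
  exact hD.sum_eq ▸ hA.add hR

theorem exists_dominates (Fam : Finset (Finset (Fin p))) (hs : ∀ T ∈ Fam, 0 ≤ s T)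
    (V : Matrix (Fin p) (Fin m) ℝ) (β : Fin p → ℝ) : ∃ B, Dominates Fam s V β B := by
  have hinv : ∀ T ∈ Fam, 0 ≤ (s T)⁻¹ := fun T hT ↦ inv_nonneg.2 (hs T hT)
  have hquad : ∀ x, quad ((1 + ∑ T ∈ Fam, (s T)⁻¹) • vecMulVec β β) x
      = (1 + ∑ T ∈ Fam, (s T)⁻¹) * (x ⬝ᵥ β) ^ 2 := fun x ↦ by
    rw [quad_smul, quad_vecMulVec, dotProduct_comm]
  refine ⟨_, IsSymm.smul (transpose_vecMulVec β β) (1 + ∑ T ∈ Fam, (s T)⁻¹),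
    fun T hT x _ ↦ ?_, fun j ↦ ?_⟩
  · rw [hquad, div_eq_inv_mul]
    have hle : (s T)⁻¹ ≤ ∑ S ∈ Fam, (s S)⁻¹ := Finset.single_le_sum hinv hT
    gcongr
    linarith
  · rw [hquad]
    exact le_mul_of_one_le_left (sq_nonneg _) (le_add_of_nonneg_right (Finset.sum_nonneg hinv))

open scoped Matrix.Norms.Elementwise

/-- The closed convex cone of pairs `(A, π)` as in `IsDecomposition`. The components `A T` with
`T ∉ Fam` and the weights of the zero columns of `V` play no role in a decomposition; they are
set to zero so that the cone meets the kernel of `decompositionMap` only at the origin. -/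
noncomputable def decompositionCone (Fam : Finset (Finset (Fin p))) (V : Matrix (Fin p) (Fin m) ℝ) :
    ProperCone ℝ ((Finset (Fin p) → Matrix (Fin p) (Fin p) ℝ) × (Fin m → ℝ)) where
  carrier := {x | (∀ T, (x.1 T).PosSemidef) ∧
    (∀ T i j, (T ∉ Fam ∨ i ∉ T ∨ j ∉ T) → x.1 T i j = 0) ∧ (∀ j, 0 ≤ x.2 j) ∧
    ∀ j, V.col j = 0 → x.2 j = 0}
  add_mem' {x y} hx hy := ⟨fun T ↦ (hx.1 T).add (hy.1 T),
    fun T i j h ↦ (congrArg₂ (· + ·) (hx.2.1 T i j h) (hy.2.1 T i j h)).trans (add_zero 0),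
    fun j ↦ add_nonneg (hx.2.2.1 j) (hy.2.2.1 j),
    fun j h ↦ (congrArg₂ (· + ·) (hx.2.2.2 j h) (hy.2.2.2 j h)).trans (add_zero 0)⟩
  zero_mem' := ⟨fun _ ↦ .zero, fun _ _ _ _ ↦ rfl, fun _ ↦ le_rfl, fun _ _ ↦ rfl⟩
  smul_mem' c x hx := ⟨fun T ↦ (hx.1 T).smul (a := (c : ℝ)) c.2,
    fun T i j h ↦ mul_eq_zero_of_right _ (hx.2.1 T i j h),
    fun j ↦ mul_nonneg c.2 (hx.2.2.1 j),
    fun j h ↦ mul_eq_zero_of_right _ (hx.2.2.2 j h)⟩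
  isClosed' := by
    simp only [Set.ofPred_and, Set.ofPred_forall]
    refine (isClosed_iInter fun T ↦ isClosed_setOf_posSemidef.preimage (by fun_prop)).inter
      (.inter ?_ (.inter ?_ ?_))
    · exact isClosed_iInter fun T ↦ isClosed_iInter fun i ↦ isClosed_iInter fun j ↦
        isClosed_iInter fun _ ↦ isClosed_eq (by fun_prop) continuous_const
    · exact isClosed_iInter fun j ↦ isClosed_le continuous_const (by fun_prop)
    · exact isClosed_iInter fun j ↦ isClosed_iInter fun _ ↦
        isClosed_eq (by fun_prop) continuous_const

/-- The linear map `(A, π) ↦ ∑_{T ∈ Fam} A_T + V diag(π) Vᵀ`. -/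
noncomputable def decompositionMap (Fam : Finset (Finset (Fin p))) (V : Matrix (Fin p) (Fin m) ℝ) :
    (Finset (Fin p) → Matrix (Fin p) (Fin p) ℝ) × (Fin m → ℝ) →ₗ[ℝ] Matrix (Fin p) (Fin p) ℝ where
  toFun x := ∑ T ∈ Fam, x.1 T + V * diagonal x.2 * Vᵀ
  map_add' x y := by
    rw [Prod.fst_add, Prod.snd_add, Pi.add_def x.2, ← diagonal_add, Matrix.mul_add, Matrix.add_mul,
      add_add_add_comm, ← Finset.sum_add_distrib]
    rfl
  map_smul' c x := by
    simp only [Prod.smul_fst, Prod.smul_snd, Pi.smul_apply, ← Finset.smul_sum, diagonal_smul,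
      Matrix.mul_smul, Matrix.smul_mul, smul_add, RingHom.id_apply]

theorem decompositionMap_apply (A : Finset (Fin p) → Matrix (Fin p) (Fin p) ℝ) (π : Fin m → ℝ) :
    decompositionMap Fam V (A, π) = ∑ T ∈ Fam, A T + V * diagonal π * Vᵀ := rfl

/-- The linear objective `(A, π) ↦ βᵀ V diag(π) Vᵀ β + ∑_{T ∈ Fam} βᵀ A_T β / s_T`. -/
noncomputable def decompositionValue (Fam : Finset (Finset (Fin p))) (s : Finset (Fin p) → ℝ)
    (V : Matrix (Fin p) (Fin m) ℝ) (β : Fin p → ℝ) :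
    (Finset (Fin p) → Matrix (Fin p) (Fin p) ℝ) × (Fin m → ℝ) →ₗ[ℝ] ℝ where
  toFun x := quad (V * diagonal x.2 * Vᵀ) β + ∑ T ∈ Fam, quad (x.1 T) β / s T
  map_add' x y := by
    rw [Prod.fst_add, Prod.snd_add, Pi.add_def x.2, ← diagonal_add, Matrix.mul_add, Matrix.add_mul,
      quad_add, add_add_add_comm, ← Finset.sum_add_distrib]
    simp only [Pi.add_apply, quad_add, add_div]
  map_smul' c x := by
    simp only [Prod.smul_fst, Prod.smul_snd, Pi.smul_apply, diagonal_smul, Matrix.mul_smul,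
      Matrix.smul_mul, quad_smul, mul_div_assoc, ← Finset.mul_sum, smul_eq_mul, mul_add,
      RingHom.id_apply]

theorem decompositionValue_apply (A : Finset (Fin p) → Matrix (Fin p) (Fin p) ℝ)
    (π : Fin m → ℝ) :
    decompositionValue Fam s V β (A, π)
      = quad (V * diagonal π * Vᵀ) β + ∑ T ∈ Fam, quad (A T) β / s T := rfl

theorem isDecomposition_of_mem_decompositionCone
    {x : (Finset (Fin p) → Matrix (Fin p) (Fin p) ℝ) × (Fin m → ℝ)}
    (hx : x ∈ decompositionCone Fam V) :
    IsDecomposition Fam (decompositionMap Fam V x) V x.1 (V * diagonal x.2 * Vᵀ) x.2 :=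
  ⟨rfl, fun T _ i j h ↦ hx.2.1 T i j (.inr h), fun T _ ↦ hx.1 T, rfl, hx.2.2.1⟩

open scoped MatrixOrder in
theorem eq_zero_of_decompositionMap_eq_zero
    {x : (Finset (Fin p) → Matrix (Fin p) (Fin p) ℝ) × (Fin m → ℝ)}
    (hx : x ∈ decompositionCone Fam V) (h0 : decompositionMap Fam V x = 0) : x = 0 := by
  obtain ⟨hpsd, hsupp, hπ, hcol⟩ := hx
  have hA : ∀ T ∈ Fam, 0 ≤ x.1 T := fun T _ ↦ (hpsd T).nonneg
  have hR : ∀ j ∈ Finset.univ, 0 ≤ x.2 j • vecMulVec (V.col j) (V.col j) := fun j _ ↦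
    ((posSemidef_vecMulVec_self_star (V.col j)).smul (hπ j)).nonneg
  obtain ⟨hsumA, hsumR⟩ : ∑ T ∈ Fam, x.1 T = 0 ∧
      ∑ j, x.2 j • vecMulVec (V.col j) (V.col j) = 0 := by
    rw [← add_eq_zero_iff_of_nonneg (Finset.sum_nonneg hA) (Finset.sum_nonneg hR),
      ← mul_diagonal_mul_transpose_eq_sum]
    exact h0
  refine Prod.ext (funext fun T ↦ ?_) (funext fun j ↦ ?_)
  · by_cases hT : T ∈ Fam
    · exact (Finset.sum_eq_zero_iff_of_nonneg hA).1 hsumA T hT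
    · ext i j
      exact hsupp T i j (.inl hT)
  · rcases smul_eq_zero.1 ((Finset.sum_eq_zero_iff_of_nonneg hR).1 hsumR j (Finset.mem_univ j))
      with hj | hj
    · exact hj
    · exact hcol j ((vecMulVec_eq_zero.1 hj).elim id id)

theorem decompositionMap_single_vecMulVec {T : Finset (Fin p)} (hT : T ∈ Fam) (x : Fin p → ℝ) :
    decompositionMap Fam V (Pi.single T (vecMulVec x x), 0) = vecMulVec x x := by
  rw [decompositionMap_apply, Finset.sum_eq_single_of_mem T hT fun S _ hS ↦ ?_, Pi.single_eq_same,
    diagonal_zero', Matrix.mul_zero, Matrix.zero_mul, add_zero]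
  exact Pi.single_eq_of_ne hS _

theorem decompositionMap_single_one (j : Fin m) :
    decompositionMap Fam V (0, Pi.single j 1) = vecMulVec (V.col j) (V.col j) := by
  rw [decompositionMap_apply, mul_diagonal_mul_transpose_eq_sum,
    Finset.sum_eq_single_of_mem j (Finset.mem_univ j) fun i _ hi ↦ ?_]
  · simp only [Pi.zero_apply, Finset.sum_const_zero, zero_add, Pi.single_eq_same, one_smul]
  · simp only [Pi.single_eq_of_ne hi, zero_smul]

theorem decompositionValue_single_vecMulVec {T : Finset (Fin p)} (hT : T ∈ Fam) (x : Fin p → ℝ) :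
    decompositionValue Fam s V β (Pi.single T (vecMulVec x x), 0) = (x ⬝ᵥ β) ^ 2 / s T := by
  rw [decompositionValue_apply, Finset.sum_eq_single_of_mem T hT fun S _ hS ↦ ?_,
    quad_mul_diagonal_mul_transpose]
  · simp only [Pi.zero_apply, zero_mul, Finset.sum_const_zero, zero_add, Pi.single_eq_same,
      quad_vecMulVec]
  · simp only [Pi.single_eq_of_ne hS, quad_zero, zero_div]

theorem decompositionValue_single_one (j : Fin m) :
    decompositionValue Fam s V β (0, Pi.single j 1) = (V.col j ⬝ᵥ β) ^ 2 := by
  rw [decompositionValue_apply]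
  simp only [quad_mul_diagonal_mul_transpose, Pi.zero_apply, quad_zero, zero_div,
    Finset.sum_const_zero, add_zero, Pi.single_apply, ite_mul, one_mul, zero_mul,
    Finset.sum_ite_eq', Finset.mem_univ, if_true]

theorem single_vecMulVec_mem_decompositionCone {T : Finset (Fin p)} (hT : T ∈ Fam)
    {x : Fin p → ℝ} (hx : ∀ i ∉ T, x i = 0) :
    (Pi.single T (vecMulVec x x), 0) ∈ decompositionCone Fam V := by
  refine ⟨fun S ↦ ?_, fun S i k hik ↦ ?_, fun _ ↦ le_rfl, fun _ _ ↦ rfl⟩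
  · rcases eq_or_ne S T with rfl | hS
    · simpa only [Pi.single_eq_same, star_trivial] using posSemidef_vecMulVec_self_star x
    · simpa only [Pi.single_eq_of_ne hS] using PosSemidef.zero
  · rcases eq_or_ne S T with rfl | hS
    · simp only [Pi.single_eq_same, vecMulVec_apply, mul_eq_zero]
      exact (hik.resolve_left (not_not_intro hT)).imp (hx i) (hx k)
    · simp only [Pi.single_eq_of_ne hS, Matrix.zero_apply]

theorem single_one_mem_decompositionCone {j : Fin m} (hj : V.col j ≠ 0) :
    (0, Pi.single j 1) ∈ decompositionCone Fam V := by
  refine ⟨fun _ ↦ .zero, fun _ _ _ _ ↦ rfl, fun i ↦ ?_, fun i hi ↦ ?_⟩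
  · exact (Pi.single_nonneg.2 zero_le_one : (0 : Fin m → ℝ) ≤ Pi.single j 1) i
  · exact Pi.single_eq_of_ne (fun hij : i = j ↦ hj (hij ▸ hi)) _

theorem dominates_of_forall_mem_decompositionCone {B : Matrix (Fin p) (Fin p) ℝ} (hB : B.IsSymm)
    (h : ∀ x ∈ decompositionCone Fam V,
      decompositionValue Fam s V β x ≤ matInner (decompositionMap Fam V x) B) :
    Dominates Fam s V β B := by
  refine ⟨hB, fun T hT x hx ↦ ?_, fun j ↦ ?_⟩
  · simpa only [decompositionValue_single_vecMulVec hT, decompositionMap_single_vecMulVec hT,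
      matInner_vecMulVec] using h _ (single_vecMulVec_mem_decompositionCone hT hx)
  · rcases eq_or_ne (V.col j) 0 with hj | hj
    · rw [hj, zero_dotProduct, quad_zero_right, sq, zero_mul]
    · simpa only [decompositionValue_single_one, decompositionMap_single_one, matInner_vecMulVec]
        using h _ (single_one_mem_decompositionCone hj)

theorem exists_isDecomposition_le {Q : Matrix (Fin p) (Fin p) ℝ} (hQ : Q.IsSymm)
    {B₀ : Matrix (Fin p) (Fin p) ℝ} (hB₀ : Dominates Fam s V β B₀) {v : ℝ}
    (hv : ∀ B, Dominates Fam s V β B → v ≤ matInner Q B) :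
    ∃ A R π, IsDecomposition Fam Q V A R π ∧ v ≤ quad R β + ∑ T ∈ Fam, quad (A T) β / s T := by
  have hweak : ∀ g : StrongDual ℝ (Matrix (Fin p) (Fin p) ℝ), (∀ x ∈ decompositionCone Fam V,
      decompositionValue Fam s V β x ≤ g (decompositionMap Fam V x)) → v ≤ g Q := fun g hg ↦ by
    obtain ⟨B, hB, hgB⟩ := exists_isSymm_forall_apply_eq_matInner g.toLinearMap
    rw [← ContinuousLinearMap.coe_coe, hgB Q hQ]
    exact hv B (dominates_of_forall_mem_decompositionCone hB fun x hx ↦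
      (hg x hx).trans_eq (hgB _ (isDecomposition_of_mem_decompositionCone hx).isSymm))
  obtain ⟨x, hx, rfl, hvx⟩ := exists_mem_map_eq_and_le (decompositionCone Fam V)
    (decompositionMap Fam V).toContinuousLinearMap
    (decompositionValue Fam s V β).toContinuousLinearMap
    (fun x hx h0 ↦ eq_zero_of_decompositionMap_eq_zero hx h0) (q := Q) (v := v)
    (g₀ := (matInnerₗ B₀).toContinuousLinearMap)
    (fun x hx ↦ hB₀.value_le_matInner (isDecomposition_of_mem_decompositionCone hx)) hweak
  exact ⟨_, _, _, isDecomposition_of_mem_decompositionCone hx, hvx⟩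

end Duality

section TruncatedMass

variable {p m : ℕ}

/-- The denominator `min {1, z(T)}` in the definition of `phi`. -/
noncomputable def truncatedMass (z : Fin p → ℝ) (T : Finset (Fin p)) : ℝ :=
  min 1 (∑ i ∈ T, z i)

variable {z : Fin p → ℝ}

theorem truncatedMass_nonneg (hz : 0 ≤ z) (T : Finset (Fin p)) : 0 ≤ truncatedMass z T :=
  le_min zero_le_one (Finset.sum_nonneg fun i _ ↦ hz i)

theorem eq_zero_of_truncatedMass_eq_zero (hz : 0 ≤ z) {T : Finset (Fin p)}
    (h : truncatedMass z T = 0) : ∀ i ∈ T, z i = 0 := by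
  have hsum : ∑ i ∈ T, z i = 0 :=
    (min_choice 1 (∑ i ∈ T, z i)).elim (fun h1 ↦ absurd (h1.symm.trans h) one_ne_zero)
      fun h1 ↦ h1.symm.trans h
  exact (Finset.sum_eq_zero_iff_of_nonneg fun i _ ↦ hz i).1 hsum

theorem truncatedMass_singleton {i : Fin p} (hz : z i ≤ 1) : truncatedMass z {i} = z i := by
  rw [truncatedMass, Finset.sum_singleton, min_eq_right hz]

theorem truncatedMass_pair {i j : Fin p} (hij : i ≠ j) :
    truncatedMass z {i, j} = min 1 (z i + z j) := by
  rw [truncatedMass, Finset.sum_pair hij]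

theorem ratio_eq_coe_div {s d : ℝ} (h : d = 0 → s ≤ 0) : ratio s d = ((s / d : ℝ) : EReal) := by
  rw [ratio]
  split_ifs with hd hs
  · exact absurd hs (h hd).not_gt
  · rw [hd, div_zero, EReal.coe_zero]
  · rfl

theorem dotProduct_eq_zero_of_supp {T : Finset (Fin p)} {x β : Fin p → ℝ}
    (hx : ∀ i ∉ T, x i = 0) (hβ : ∀ i ∈ T, β i = 0) : x ⬝ᵥ β = 0 :=
  Finset.sum_eq_zero fun i _ ↦ by
    by_cases hi : i ∈ T
    · rw [hβ i hi, mul_zero]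
    · rw [hx i hi, zero_mul]

theorem quad_eq_zero_of_supp {T : Finset (Fin p)} {A : Matrix (Fin p) (Fin p) ℝ} {β : Fin p → ℝ}
    (hA : ∀ i j, i ∉ T ∨ j ∉ T → A i j = 0) (hβ : ∀ i ∈ T, β i = 0) : quad A β = 0 := by
  have hAβ : A *ᵥ β = 0 := funext fun i ↦
    dotProduct_eq_zero_of_supp (fun j hj ↦ hA i j (.inr hj)) hβ
  rw [quad, hAβ, dotProduct_zero]

theorem toEReal_finset_sum {ι : Type*} (s : Finset ι) (f : ι → ℝ) :
    ((∑ i ∈ s, f i : ℝ) : EReal) = ∑ i ∈ s, (f i : EReal) :=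
  map_sum (⟨⟨Real.toEReal, EReal.coe_zero⟩, EReal.coe_add⟩ : ℝ →+ EReal) f s

variable {Fam : Finset (Finset (Fin p))} {Q : Matrix (Fin p) (Fin p) ℝ}
  {V : Matrix (Fin p) (Fin m) ℝ} {β : Fin p → ℝ}

theorem IsDecomposition.value_eq_coe {A : Finset (Fin p) → Matrix (Fin p) (Fin p) ℝ}
    {R : Matrix (Fin p) (Fin p) ℝ} {π : Fin m → ℝ} (hD : IsDecomposition Fam Q V A R π)
    (hz : 0 ≤ z) (hβ : ∀ i, z i = 0 → β i = 0) :
    ((quad R β : ℝ) : EReal) + ∑ T ∈ Fam, ratio (quad (A T) β) (min 1 (∑ i ∈ T, z i))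
      = ((quad R β + ∑ T ∈ Fam, quad (A T) β / truncatedMass z T : ℝ) : EReal) := by
  have hratio : ∀ T ∈ Fam, ratio (quad (A T) β) (min 1 (∑ i ∈ T, z i))
      = ((quad (A T) β / truncatedMass z T : ℝ) : EReal) := fun T hT ↦
    ratio_eq_coe_div fun h ↦ (quad_eq_zero_of_supp (hD.supp T hT) fun i hi ↦
      hβ i (eq_zero_of_truncatedMass_eq_zero hz h i hi)).le
  rw [Finset.sum_congr rfl hratio, EReal.coe_add, toEReal_finset_sum]

theorem phi_eq_iInf_dominates (hQ : Q.IsSymm) (hz : 0 ≤ z) (hβ : ∀ i, z i = 0 → β i = 0) :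
    phi Fam Q V z β
      = ⨅ (B) (_ : Dominates Fam (truncatedMass z) V β B), ((matInner Q B : ℝ) : EReal) := by
  refine le_antisymm ?_ (EReal.ge_of_forall_gt_iff_ge.1 fun v hv ↦ ?_)
  · refine le_iInf₂ fun B hB ↦ iSup_le fun A ↦ iSup_le fun R ↦ iSup_le fun π ↦ iSup_le fun hD ↦ ?_
    rw [hD.value_eq_coe hz hβ]
    exact EReal.coe_le_coe_iff.2 (hB.value_le_matInner hD)
  · obtain ⟨B₀, hB₀⟩ := exists_dominates Fam (fun T _ ↦ truncatedMass_nonneg hz T) V β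
    obtain ⟨A, R, π, hD, hvA⟩ := exists_isDecomposition_le hQ hB₀ fun B hB ↦
      EReal.coe_le_coe_iff.1 (hv.le.trans (iInf₂_le B hB))
    refine (EReal.coe_le_coe_iff.2 hvA).trans ?_
    rw [← hD.value_eq_coe hz hβ]
    exact le_iSup_of_le A (le_iSup_of_le R (le_iSup_of_le π (le_iSup_of_le hD le_rfl)))

end TruncatedMass

section InnerProblem

open Matrix

variable {n p m : ℕ} {T : Finset (Fin p)} {w : ℝ} {β z : Fin p → ℝ}
  {B : Matrix (Fin p) (Fin p) ℝ} {V : Matrix (Fin p) (Fin m) ℝ}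

/-- The bordered matrix with corner `w`, border `β` and block `B` is positive semidefinite on the
vectors `(t, x)` with `x` supported on `T`. -/
def BorderedNonneg (T : Finset (Fin p)) (w : ℝ) (β : Fin p → ℝ) (B : Matrix (Fin p) (Fin p) ℝ) :
    Prop :=
  ∀ (t : ℝ) (x : Fin p → ℝ), (∀ i ∉ T, x i = 0) → 0 ≤ w * t ^ 2 + 2 * t * (x ⬝ᵥ β) + quad B x

theorem BorderedNonneg.mono {s : ℝ} (h : BorderedNonneg T w β B) (hws : w ≤ s) :
    BorderedNonneg T s β B := fun t x hx ↦
  (h t x hx).trans (by gcongr)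

theorem BorderedNonneg.corner_nonneg (h : BorderedNonneg T w β B) : 0 ≤ w := by
  simpa only [one_pow, mul_one, zero_dotProduct, mul_zero, add_zero, quad_zero_right]
    using h 1 0 fun _ _ ↦ rfl

theorem BorderedNonneg.eq_zero (h : BorderedNonneg T 0 β B) : ∀ i ∈ T, β i = 0 := fun i hi ↦ by
  have hdot : ∀ c : ℝ, 0 ≤ c * β i := fun c ↦ by
    rw [← single_dotProduct]
    refine nonneg_of_forall_le_add_mul (a := quad B (Pi.single i c)) (v := 0) fun t _ ↦ ?_
    have hsupp : ∀ j ∉ T, (Pi.single i c : Fin p → ℝ) j = 0 := fun j hj ↦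
      Pi.single_eq_of_ne (ne_of_mem_of_not_mem hi hj).symm _
    linarith [h (t / 2) _ hsupp]
  linarith [hdot 1, hdot (-1)]

theorem BorderedNonneg.dominatesOn (h : BorderedNonneg T w β B) : DominatesOn T w β B := by
  intro x hx
  rcases h.corner_nonneg.eq_or_lt with rfl | hw
  · simpa only [ne_eq, OfNat.ofNat_ne_zero, not_false_eq_true, zero_pow, mul_zero, zero_mul,
      zero_add, div_zero] using h 0 x hx
  · have hmin := h (-(x ⬝ᵥ β) / w) x hx
    have hval : w * (-(x ⬝ᵥ β) / w) ^ 2 + 2 * (-(x ⬝ᵥ β) / w) * (x ⬝ᵥ β) = -((x ⬝ᵥ β) ^ 2 / w) := by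
      field_simp
      ring
    linarith

theorem DominatesOn.borderedNonneg (h : DominatesOn T w β B) (hw : 0 ≤ w)
    (hβ : w = 0 → ∀ i ∈ T, β i = 0) : BorderedNonneg T w β B := by
  intro t x hx
  have hB := h x hx
  rcases hw.eq_or_lt with rfl | hw
  · simpa only [dotProduct_eq_zero_of_supp hx (hβ rfl), zero_mul, mul_zero, zero_add, div_zero]
      using hB
  · have hsq : w * t ^ 2 + 2 * t * (x ⬝ᵥ β) + (x ⬝ᵥ β) ^ 2 / w = w * (t + (x ⬝ᵥ β) / w) ^ 2 := by
      field_simp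
      ring
    have hnonneg : 0 ≤ w * (t + (x ⬝ᵥ β) / w) ^ 2 := by positivity
    linarith

theorem quad_single (B : Matrix (Fin p) (Fin p) ℝ) (i : Fin p) (a : ℝ) :
    quad B (Pi.single i a) = a ^ 2 * B i i := by
  rw [quad, single_dotProduct, mulVec_single, Pi.smul_apply, op_smul_eq_smul, smul_eq_mul,
    col_apply]
  ring

theorem quad_single_add_single (B : Matrix (Fin p) (Fin p) ℝ) (i j : Fin p) (a b : ℝ) :
    quad B (Pi.single i a + Pi.single j b)
      = a ^ 2 * B i i + a * b * (B i j + B j i) + b ^ 2 * B j j := by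
  simp only [quad, mulVec_add, add_dotProduct, single_dotProduct, mulVec_single, Pi.add_apply,
    Pi.smul_apply, op_smul_eq_smul, smul_eq_mul, col_apply]
  ring

theorem posSemidef_fin_two_iff {a b c : ℝ} :
    (!![a, b; b, c] : Matrix (Fin 2) (Fin 2) ℝ).PosSemidef ↔
      ∀ t x : ℝ, 0 ≤ a * t ^ 2 + 2 * t * (x * b) + x ^ 2 * c := by
  have hsymm : (!![a, b; b, c] : Matrix (Fin 2) (Fin 2) ℝ).IsSymm :=
    IsSymm.ext fun i j ↦ by fin_cases i <;> fin_cases j <;> rfl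
  have hquad : ∀ x, quad !![a, b; b, c] x
      = a * x 0 ^ 2 + 2 * x 0 * (x 1 * b) + x 1 ^ 2 * c := fun x ↦ by
    simp only [quad, dotProduct, mulVec, Fin.sum_univ_two, of_apply, cons_val_zero, cons_val_one]
    ring
  simp only [posSemidef_iff_isSymm_and_quad_nonneg, hsymm, true_and, hquad]
  exact ⟨fun h t x ↦ h ![t, x], fun h x ↦ h _ _⟩

theorem posSemidef_fin_three_iff {w b c d e f : ℝ} :
    (!![w, b, c; b, d, e; c, e, f] : Matrix (Fin 3) (Fin 3) ℝ).PosSemidef ↔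
      ∀ t x y : ℝ, 0 ≤ w * t ^ 2 + 2 * t * (x * b + y * c)
        + (x ^ 2 * d + 2 * (x * y * e) + y ^ 2 * f) := by
  have hsymm : (!![w, b, c; b, d, e; c, e, f] : Matrix (Fin 3) (Fin 3) ℝ).IsSymm :=
    IsSymm.ext fun i j ↦ by fin_cases i <;> fin_cases j <;> rfl
  have hquad : ∀ x, quad !![w, b, c; b, d, e; c, e, f] x
      = w * x 0 ^ 2 + 2 * x 0 * (x 1 * b + x 2 * c)
        + (x 1 ^ 2 * d + 2 * (x 1 * x 2 * e) + x 2 ^ 2 * f) := fun x ↦ by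
    simp only [quad, dotProduct, mulVec, Fin.sum_univ_three, of_apply, cons_val]
    ring
  simp only [posSemidef_iff_isSymm_and_quad_nonneg, hsymm, true_and, hquad]
  exact ⟨fun h t x y ↦ h ![t, x, y], fun h x ↦ h _ _ _⟩

theorem borderedNonneg_singleton_iff {i : Fin p} :
    BorderedNonneg {i} w β B ↔
      (!![w, β i; β i, B i i] : Matrix (Fin 2) (Fin 2) ℝ).PosSemidef := by
  have hform : ∀ (t x : ℝ), w * t ^ 2 + 2 * t * (Pi.single i x ⬝ᵥ β) + quad B (Pi.single i x)
      = w * t ^ 2 + 2 * t * (x * β i) + x ^ 2 * B i i := fun t x ↦ by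
    rw [single_dotProduct, quad_single]
  rw [posSemidef_fin_two_iff]
  refine ⟨fun h t x ↦ hform t x ▸ h t _ fun j hj ↦ ?_, fun h t x hx ↦ ?_⟩
  · exact Pi.single_eq_of_ne (Finset.notMem_singleton.1 hj) _
  · have hxi : x = Pi.single i (x i) := by
      ext j
      rcases eq_or_ne j i with rfl | hj
      · rw [Pi.single_eq_same]
      · rw [Pi.single_eq_of_ne hj, hx j (Finset.notMem_singleton.2 hj)]
    rw [hxi, hform]
    exact h t _

theorem borderedNonneg_pair_iff (hB : B.IsSymm) {i j : Fin p} (hij : i ≠ j) :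
    BorderedNonneg {i, j} w β B ↔
      (!![w, β i, β j;
          β i, B i i, B i j;
          β j, B i j, B j j] : Matrix (Fin 3) (Fin 3) ℝ).PosSemidef := by
  have hform : ∀ t x y : ℝ, w * t ^ 2 + 2 * t * ((Pi.single i x + Pi.single j y) ⬝ᵥ β)
      + quad B (Pi.single i x + Pi.single j y)
      = w * t ^ 2 + 2 * t * (x * β i + y * β j)
        + (x ^ 2 * B i i + 2 * (x * y * B i j) + y ^ 2 * B j j) := fun t x y ↦ by
    rw [add_dotProduct, single_dotProduct, single_dotProduct, quad_single_add_single, hB.apply i j]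
    ring
  rw [posSemidef_fin_three_iff]
  refine ⟨fun h t x y ↦ hform t x y ▸ h t _ fun k hk ↦ ?_, fun h t x hx ↦ ?_⟩
  · rw [Finset.mem_insert, Finset.mem_singleton, not_or] at hk
    rw [Pi.add_apply, Pi.single_eq_of_ne hk.1, Pi.single_eq_of_ne hk.2, add_zero]
  · have hxsum : x = Pi.single i (x i) + Pi.single j (x j) := by
      ext k
      rw [Pi.add_apply]
      rcases eq_or_ne k i with rfl | hki
      · rw [Pi.single_eq_same, Pi.single_eq_of_ne hij, add_zero]
      rcases eq_or_ne k j with rfl | hkj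
      · rw [Pi.single_eq_same, Pi.single_eq_of_ne hki, zero_add]
      · rw [Pi.single_eq_of_ne hki, Pi.single_eq_of_ne hkj, add_zero]
        exact hx k (by simp [hki, hkj])
    rw [hxsum, hform]
    exact h t _ _

theorem forall_mem_pairs {P : Finset (Fin p) → Prop} :
    (∀ T ∈ pairs p, P T) ↔ P ∅ ∧ (∀ i, P {i}) ∧ ∀ i j, i < j → P {i, j} := by
  simp only [pairs, Finset.mem_filter, Finset.mem_univ, true_and]
  refine ⟨fun h ↦ ⟨h ∅ (Nat.zero_le 2), fun i ↦ h {i} (Nat.le_succ 1),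
    fun i j _ ↦ h {i, j} Finset.card_le_two⟩, fun ⟨hempty, hsingle, hpair⟩ T hT ↦ ?_⟩
  interval_cases hcard : T.card
  · exact Finset.card_eq_zero.1 hcard ▸ hempty
  · obtain ⟨i, rfl⟩ := Finset.card_eq_one.1 hcard
    exact hsingle i
  · obtain ⟨i, j, hij, rfl⟩ := Finset.card_eq_two.1 hcard
    rcases hij.lt_or_gt with hij | hji
    · exact hpair i j hij
    · exact Finset.pair_comm i j ▸ hpair j i hji

theorem quad_sub_vecMulVec_nonneg_iff {x : Fin p → ℝ} :
    0 ≤ quad (B - vecMulVec β β) x ↔ (x ⬝ᵥ β) ^ 2 ≤ quad B x := by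
  rw [quad_sub, quad_vecMulVec, sub_nonneg, dotProduct_comm]

theorem InnerFeasible.dominates {w : Fin p → Fin p → ℝ} (h : InnerFeasible V β z w B)
    (hz : z ≤ 1) : Dominates (pairs p) (truncatedMass z) V β B where
  symm := h.symm
  on_mem := by
    refine forall_mem_pairs.2 ⟨fun x hx ↦ ?_, fun i ↦ ?_, fun i j hij ↦ ?_⟩
    · have hx0 : x = 0 := funext fun i ↦ hx i (Finset.notMem_empty i)
      rw [hx0, zero_dotProduct, quad_zero_right, sq, zero_mul, zero_div]
    · rw [truncatedMass_singleton (hz i)]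
      exact (borderedNonneg_singleton_iff.2 (h.psd_two i)).dominatesOn
    · rw [truncatedMass_pair hij.ne]
      exact (((borderedNonneg_pair_iff h.symm hij.ne).2 (h.psd_three i j hij)).mono
        (h.w_le i j hij)).dominatesOn
  on_col j := quad_sub_vecMulVec_nonneg_iff.1 (h.rank_one j)

theorem InnerFeasible.eq_zero_of_eq_zero {w : Fin p → Fin p → ℝ} (h : InnerFeasible V β z w B)
    {i : Fin p} (hi : z i = 0) : β i = 0 :=
  (hi ▸ borderedNonneg_singleton_iff.2 (h.psd_two i) : BorderedNonneg {i} 0 β B).eq_zero i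
    (Finset.mem_singleton_self i)

theorem Dominates.innerFeasible (h : Dominates (pairs p) (truncatedMass z) V β B)
    (hz : ∀ i, z i ∈ Set.Icc (0 : ℝ) 1) (hβ : ∀ i, z i = 0 → β i = 0) :
    InnerFeasible V β z (fun i j ↦ min 1 (z i + z j)) B := by
  obtain ⟨-, hsingle, hpair⟩ := forall_mem_pairs.1 h.on_mem
  have hz0 : 0 ≤ z := fun i ↦ (hz i).1
  have hbordered : ∀ T, DominatesOn T (truncatedMass z T) β B →
      BorderedNonneg T (truncatedMass z T) β B := fun T hT ↦
    hT.borderedNonneg (truncatedMass_nonneg hz0 T) fun h0 i hi ↦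
      hβ i (eq_zero_of_truncatedMass_eq_zero hz0 h0 i hi)
  refine ⟨h.symm, fun i ↦ ?_, fun i j _ ↦ le_min zero_le_one (add_nonneg (hz0 i) (hz0 j)),
    fun i j _ ↦ le_rfl, fun i j hij ↦ ?_, fun j ↦ quad_sub_vecMulVec_nonneg_iff.2 (h.on_col j)⟩
  · rw [← truncatedMass_singleton (hz i).2]
    exact borderedNonneg_singleton_iff.1 (hbordered _ (hsingle i))
  · rw [← truncatedMass_pair hij.ne]
    exact (borderedNonneg_pair_iff h.symm hij.ne).1 (hbordered _ (hpair i j hij))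

theorem exists_innerFeasible (V : Matrix (Fin p) (Fin m) ℝ) (hz : ∀ i, z i ∈ Set.Icc (0 : ℝ) 1)
    (hβ : ∀ i, z i = 0 → β i = 0) : ∃ w B, InnerFeasible V β z w B :=
  let ⟨_, hB⟩ := exists_dominates (pairs p)
    (fun T _ ↦ truncatedMass_nonneg (fun i ↦ (hz i).1) T) V β
  ⟨_, _, hB.innerFeasible hz hβ⟩

theorem isSymm_gram (X : Matrix (Fin n) (Fin p) ℝ) (lam : ℝ) : (gram X lam).IsSymm := by
  rw [gram, IsSymm, transpose_add, transpose_mul, transpose_transpose, transpose_smul,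
    transpose_one]

theorem phi_eq_innerValue (X : Matrix (Fin n) (Fin p) ℝ) (lam : ℝ) (V : Matrix (Fin p) (Fin m) ℝ)
    (hz : ∀ i, z i ∈ Set.Icc (0 : ℝ) 1) (hβ : ∀ i, z i = 0 → β i = 0) :
    phi (pairs p) (gram X lam) V z β = innerValue X lam V β z := by
  rw [phi_eq_iInf_dominates (isSymm_gram X lam) (fun i ↦ (hz i).1) hβ]
  refine le_antisymm (le_iInf fun w ↦ le_iInf₂ fun B hB ↦ ?_) (le_iInf₂ fun B hB ↦ ?_)
  · exact iInf₂_le B (hB.dominates fun i ↦ (hz i).2)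
  · exact iInf_le_of_le _ (iInf₂_le B (hB.innerFeasible hz hβ))

end InnerProblem

section OptimalValues

open Filter Topology

variable {n p m : ℕ} {X : Matrix (Fin n) (Fin p) ℝ} {y : Fin n → ℝ} {lam mu : ℝ} {k : ℕ}
  {V : Matrix (Fin p) (Fin m) ℝ} {β z u : Fin p → ℝ}

theorem linObj_smul (X : Matrix (Fin n) (Fin p) ℝ) (y : Fin n → ℝ) (mu c : ℝ)
    (β u : Fin p → ℝ) : linObj X y mu (c • β) (c • u) = c * linObj X y mu β u := by
  simp only [linObj, Matrix.mulVec_smul, dotProduct_smul, smul_eq_mul, Pi.smul_apply,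
    ← Finset.mul_sum]
  ring

theorem ratio_sq_mul_le {c q d d' : ℝ} (hc : 0 < c) (hc1 : c ≤ 1) (hq : 0 ≤ q) (hd : 0 ≤ d)
    (hd' : c * d ≤ d') : ratio (c ^ 2 * q) d' ≤ ratio q d := by
  rcases hd.eq_or_lt with rfl | hd0
  · rcases hq.eq_or_lt with rfl | hq0
    · simp [ratio]
    · simp [ratio, hq0]
  · have hd'0 : 0 < d' := (mul_pos hc hd0).trans_le hd'
    rw [ratio_eq_coe_div fun h ↦ absurd h hd'0.ne', ratio_eq_coe_div fun h ↦ absurd h hd0.ne']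
    refine EReal.coe_le_coe_iff.2 ?_
    calc c ^ 2 * q / d' ≤ c ^ 2 * q / (c * d) := by gcongr
      _ = c * (q / d) := by field_simp
      _ ≤ q / d := mul_le_of_le_one_left (div_nonneg hq hd) hc1

theorem mul_truncatedMass_le {z' : Fin p → ℝ} {c : ℝ} (hc : 0 ≤ c) (hc1 : c ≤ 1)
    (hz : c • z ≤ z') (T : Finset (Fin p)) : c * truncatedMass z T ≤ truncatedMass z' T := by
  refine le_min ?_ ?_
  · calc c * truncatedMass z T ≤ c * 1 := by gcongr; exact min_le_left _ _
      _ ≤ 1 := by rwa [mul_one]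
  · calc c * truncatedMass z T ≤ c * ∑ i ∈ T, z i := by gcongr; exact min_le_right _ _
      _ = ∑ i ∈ T, (c • z) i := Finset.mul_sum _ _ _
      _ ≤ ∑ i ∈ T, z' i := Finset.sum_le_sum fun i _ ↦ hz i

theorem phi_smul_le (Fam : Finset (Finset (Fin p))) (Q : Matrix (Fin p) (Fin p) ℝ)
    (V : Matrix (Fin p) (Fin m) ℝ) {z' : Fin p → ℝ} (β : Fin p → ℝ) {c : ℝ} (hc : 0 < c)
    (hc1 : c ≤ 1) (hz : 0 ≤ z) (hz' : c • z ≤ z') :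
    phi Fam Q V z' (c • β) ≤ phi Fam Q V z β := by
  refine iSup_mono fun A ↦ iSup_mono fun R ↦ iSup_mono fun π ↦ iSup_mono fun hD ↦ ?_
  have hR : 0 ≤ quad R β := by
    rw [hD.rem_eq, quad_mul_diagonal_mul_transpose]
    exact Finset.sum_nonneg fun j _ ↦ mul_nonneg (hD.nonneg j) (sq_nonneg _)
  simp only [quad_smul_right]
  refine add_le_add (EReal.coe_le_coe_iff.2 ?_) (Finset.sum_le_sum fun T hT ↦ ?_)
  · exact mul_le_of_le_one_left hR (pow_le_one₀ hc.le hc1)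
  · exact ratio_sq_mul_le hc hc1 ((posSemidef_iff_isSymm_and_quad_nonneg.1 (hD.psd T hT)).2 β)
      (truncatedMass_nonneg hz T) (mul_truncatedMass_le hc.le hc1 hz' T)

theorem BaseFeasible.shrink (hk : 1 ≤ k) (h : BaseFeasible k β z u) {c : ℝ} (hc : 0 ≤ c)
    (hc1 : c ≤ 1) :
    BaseFeasible k (c • β) (fun i ↦ c * z i + (1 - c) / (p + 1)) (c • u) := by
  have hc' : 0 ≤ 1 - c := sub_nonneg.2 hc1
  have hk' : (1 : ℝ) ≤ k := by exact_mod_cast hk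
  refine ⟨?_, fun i ↦ mul_le_mul_of_nonneg_left (h.le_u i) hc, fun i ↦ ?_, fun i ↦ ⟨?_, ?_⟩,
    fun i ↦ mul_nonneg hc (h.u_nonneg i)⟩
  · have hmass : (p : ℝ) * ((1 - c) / (p + 1)) ≤ 1 - c := by
      rw [mul_div_assoc', div_le_iff₀ (by positivity)]
      linarith
    calc ∑ i, (c * z i + (1 - c) / (p + 1)) = c * ∑ i, z i + p * ((1 - c) / (p + 1)) := by
          rw [Finset.sum_add_distrib, ← Finset.mul_sum, Finset.sum_const, Finset.card_univ,
            Fintype.card_fin, nsmul_eq_mul]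
      _ ≤ c * k + (1 - c) * k := add_le_add (mul_le_mul_of_nonneg_left h.card hc)
          (hmass.trans (le_mul_of_one_le_right hc' hk'))
      _ = k := by ring
  · simpa only [Pi.smul_apply, smul_eq_mul, mul_neg]
      using mul_le_mul_of_nonneg_left (h.neg_le_u i) hc
  · exact add_nonneg (mul_nonneg hc (h.z_mem i).1) (by positivity)
  · calc c * z i + (1 - c) / (p + 1) ≤ c * 1 + (1 - c) :=
          add_le_add (mul_le_mul_of_nonneg_left (h.z_mem i).2 hc)
            (div_le_self hc' (le_add_of_nonneg_left p.cast_nonneg))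
      _ = 1 := by ring

theorem relaxObj_le_sdpObj {w : Fin p → Fin p → ℝ} {B : Matrix (Fin p) (Fin p) ℝ}
    (hz : ∀ i, z i ∈ Set.Icc (0 : ℝ) 1) (h : InnerFeasible V β z w B) :
    relaxObj X y lam mu (pairs p) V β z u ≤ ((sdpObj X y lam mu β u B : ℝ) : EReal) := by
  rw [relaxObj, sdpObj, EReal.coe_add _ (matInner _ _),
    phi_eq_innerValue X lam V hz fun _ ↦ h.eq_zero_of_eq_zero]
  exact add_le_add_right (iInf_le_of_le w (iInf₂_le B h)) _

theorem sdpValue_le_sdpObj {w : Fin p → Fin p → ℝ} {B : Matrix (Fin p) (Fin p) ℝ}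
    (h : BaseFeasible k β z u) (hB : InnerFeasible V β z w B) :
    sdpValue X y lam mu k V ≤ ((sdpObj X y lam mu β u B : ℝ) : EReal) :=
  iInf_le_of_le β (iInf_le_of_le z (iInf_le_of_le u (iInf_le_of_le w (iInf_le_of_le B
    (iInf₂_le h hB)))))

theorem relaxValue_le_relaxObj {Fam : Finset (Finset (Fin p))} (h : BaseFeasible k β z u) :
    relaxValue X y lam mu k Fam V ≤ relaxObj X y lam mu Fam V β z u :=
  iInf_le_of_le β (iInf_le_of_le z (iInf₂_le u h))

theorem sdpValue_le_relaxObj (h : BaseFeasible k β z u) (hβ : ∀ i, z i = 0 → β i = 0) :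
    sdpValue X y lam mu k V ≤ relaxObj X y lam mu (pairs p) V β z u := by
  rw [relaxObj, phi_eq_innerValue X lam V h.z_mem hβ, add_comm,
    ← EReal.sub_le_iff_le_add (.inl (EReal.coe_ne_bot _)) (.inl (EReal.coe_ne_top _))]
  refine le_iInf fun w ↦ le_iInf₂ fun B hB ↦ ?_
  rw [EReal.sub_le_iff_le_add (.inl (EReal.coe_ne_bot _)) (.inl (EReal.coe_ne_top _)),
    ← EReal.coe_add, add_comm]
  exact sdpValue_le_sdpObj h hB

theorem sdpValue_le_coe_mul_linObj_add_phi (hk : 1 ≤ k) (h : BaseFeasible k β z u) {c : ℝ}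
    (hc : 0 < c) (hc1 : c < 1) :
    sdpValue X y lam mu k V
      ≤ ((y ⬝ᵥ y + c * linObj X y mu β u : ℝ) : EReal) + phi (pairs p) (gram X lam) V z β := by
  have hstep : 0 < (1 - c) / ((p : ℝ) + 1) := div_pos (sub_pos.2 hc1) (by positivity)
  have hz : 0 ≤ z := fun i ↦ (h.z_mem i).1
  have hpos : ∀ i, 0 < c * z i + (1 - c) / (p + 1) := fun i ↦
    add_pos_of_nonneg_of_pos (mul_nonneg hc.le (hz i)) hstep
  refine (sdpValue_le_relaxObj (h.shrink hk hc.le hc1.le) fun i hi ↦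
    absurd hi (hpos i).ne').trans ?_
  rw [relaxObj, linObj_smul]
  exact add_le_add_right (phi_smul_le _ _ _ _ hc hc1.le hz
    fun i ↦ le_add_of_nonneg_right hstep.le) _

theorem tendsto_coe_add_mul_add_nhdsLT_one (a b : ℝ) (x : EReal) :
    Tendsto (fun c : ℝ ↦ ((a + c * b : ℝ) : EReal) + x) (𝓝[<] 1)
      (𝓝 (((a + b : ℝ) : EReal) + x)) := by
  have haffine : Tendsto (fun c : ℝ ↦ a + c * b) (𝓝[<] 1) (𝓝 (a + b)) :=
    tendsto_nhdsWithin_of_tendsto_nhds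
      (Continuous.tendsto' (by fun_prop) 1 (a + b) (by rw [one_mul]))
  exact (EReal.continuousAt_add (p := (_, _)) (.inl (EReal.coe_ne_top _))
    (.inl (EReal.coe_ne_bot _))).tendsto.comp
      (((continuous_coe_real_ereal.tendsto _).comp haffine).prodMk_nhds tendsto_const_nhds)

theorem relaxValue_eq_sdpValue (X : Matrix (Fin n) (Fin p) ℝ) (y : Fin n → ℝ) (lam mu : ℝ)
    (hk : 1 ≤ k) (V : Matrix (Fin p) (Fin m) ℝ) :
    relaxValue X y lam mu k (pairs p) V = sdpValue X y lam mu k V := by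
  refine le_antisymm ?_ ?_
  · refine le_iInf fun β ↦ le_iInf fun z ↦ le_iInf fun u ↦ le_iInf fun w ↦ le_iInf fun B ↦
      le_iInf₂ fun h hB ↦ ?_
    exact (relaxValue_le_relaxObj h).trans (relaxObj_le_sdpObj h.z_mem hB)
  · refine le_iInf fun β ↦ le_iInf fun z ↦ le_iInf₂ fun u h ↦
      ge_of_tendsto (tendsto_coe_add_mul_add_nhdsLT_one _ _ _) ?_
    filter_upwards [Ioo_mem_nhdsLT (zero_lt_one' ℝ)] with c hc
    exact sdpValue_le_coe_mul_linObj_add_phi hk h hc.1 hc.2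

end OptimalValues

end SparseReg

theorem proposition7_general {n p m : ℕ} (X : Matrix (Fin n) (Fin p) ℝ) (y : Fin n → ℝ)
    (lam mu : ℝ) {k : ℕ} (hk : 1 ≤ k) (V : Matrix (Fin p) (Fin m) ℝ) :
    SparseReg.relaxValue X y lam mu k (SparseReg.pairs p) V
        = SparseReg.sdpValue X y lam mu k V ∧
    (∀ β z : Fin p → ℝ, (∀ i, z i ∈ Set.Icc (0 : ℝ) 1) → (∀ i, z i = 0 → β i = 0) →
      (∃ w B, SparseReg.InnerFeasible V β z w B) ∧
      SparseReg.phi (SparseReg.pairs p) (SparseReg.gram X lam) V z β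
        = SparseReg.innerValue X lam V β z) ∧
    (∀ (β z u : Fin p → ℝ) (w : Fin p → Fin p → ℝ) (B : Matrix (Fin p) (Fin p) ℝ),
      SparseReg.BaseFeasible k β z u → SparseReg.InnerFeasible V β z w B →
      ((SparseReg.sdpObj X y lam mu β u B : ℝ) : EReal) = SparseReg.sdpValue X y lam mu k V →
      SparseReg.relaxObj X y lam mu (SparseReg.pairs p) V β z u
        = SparseReg.relaxValue X y lam mu k (SparseReg.pairs p) V) := by
  have hvalue := SparseReg.relaxValue_eq_sdpValue X y lam mu hk V
  refine ⟨hvalue, fun β z hz hβ ↦ ⟨SparseReg.exists_innerFeasible V hz hβ,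
    SparseReg.phi_eq_innerValue X lam V hz hβ⟩, fun β z u w B h hB hopt ↦ le_antisymm ?_ ?_⟩
  · rw [hvalue, ← hopt]
    exact SparseReg.relaxObj_le_sdpObj h.z_mem hB
  · exact SparseReg.relaxValue_le_relaxObj h

theorem proposition7 {n p : ℕ} (X : Matrix (Fin n) (Fin p) ℝ) (y : Fin n → ℝ)
    (lam mu : ℝ) (hlam : 0 ≤ lam) (hmu : 0 ≤ mu) (k : ℕ) (hk : 1 ≤ k)
    (V : Matrix (Fin p) (Fin (min n p)) ℝ)
    (hV : ∀ j, ∃ d : ℝ,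
      Module.End.HasEigenvector (Matrix.toLin' (Xᵀ * X)) d (fun i => V i j)) :
    -- the two problems have the same optimal value
    SparseReg.relaxValue X y lam mu k (SparseReg.pairs p) V
        = SparseReg.sdpValue X y lam mu k V ∧
    -- minimizing out `(w, B)` gives `φ` wherever `(β, z)` extends to a feasible `(w, B)`
    (∀ β z : Fin p → ℝ, (∀ i, z i ∈ Set.Icc (0 : ℝ) 1) → (∀ i, z i = 0 → β i = 0) →
      (∃ w B, SparseReg.InnerFeasible V β z w B) ∧
      SparseReg.phi (SparseReg.pairs p) (SparseReg.gram X lam) V z β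
        = SparseReg.innerValue X lam V β z) ∧
    -- every optimal solution of `SDP_LB` projects to one of the relaxation
    (∀ (β z u : Fin p → ℝ) (w : Fin p → Fin p → ℝ) (B : Matrix (Fin p) (Fin p) ℝ),
      SparseReg.BaseFeasible k β z u → SparseReg.InnerFeasible V β z w B →
      ((SparseReg.sdpObj X y lam mu β u B : ℝ) : EReal) = SparseReg.sdpValue X y lam mu k V →
      SparseReg.relaxObj X y lam mu (SparseReg.pairs p) V β z u
        = SparseReg.relaxValue X y lam mu k (SparseReg.pairs p) V) :=
  proposition7_general X y lam mu hk V
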